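/- Let $\Gamma$ be a finite, simple, undirected, connected graph (not assumed to be regular). Suppose that the adjacency matrix of $\Gamma$ has exactly $d+1$ distinct eigenvalues and that $\Gamma$ has odd-girth $2d+1$, that is, the shortest cycles of odd length in $\Gamma$ have length $2d+1$. Then $\Gamma$ is distance-regular: there are integers $b_i, c_i \ge 0$ such that, for every $i \ge 0$ and any two vertices $u,v$ of $\Gamma$ at distance $i$, the vertex $v$ has exactly $c_i$ neighbours at distance $i-1$ from $u$ and exactly $b_i$ neighbours at distance $i+1$ from $u$. -/

import Mathlib

namespace SimpleGraph

/-- The odd-girth of a graph: the length of a shortest cycle of odd length, or `⊤` if there is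
no cycle of odd length. -/
noncomputable def oddGirth {V : Type*} (G : SimpleGraph V) : ℕ∞ :=
  ⨅ (a : V) (w : G.Walk a a) (_ : w.IsCycle) (_ : Odd w.length), (w.length : ℕ∞)

/-- A graph is distance-regular if it is connected and there are numbers `b i`, `c i` such that
any two vertices `u`, `v` at distance `i` satisfy: exactly `c i` neighbours of `v` are at distance
`i - 1` from `u`, and exactly `b i` neighbours of `v` are at distance `i + 1` from `u`.
(For `i = 0` the first set is empty; the case `i = 0` of the second condition says that the graph
is regular of degree `b 0`.) -/
def IsDistanceRegular {V : Type*} [Fintype V] (G : SimpleGraph V) : Prop :=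
  G.Connected ∧ ∃ b c : ℕ → ℕ, ∀ (i : ℕ) (u v : V), G.dist u v = i →
    {w : V | G.Adj v w ∧ G.dist u w + 1 = i}.ncard = c i ∧
    {w : V | G.Adj v w ∧ G.dist u w = i + 1}.ncard = b i

/-- The set of eigenvalues of the adjacency matrix of a finite graph (a symmetric real matrix, so
that all its eigenvalues are real). -/
def adjEigenvalues {V : Type*} [Fintype V] [DecidableEq V] (G : SimpleGraph V)
    [DecidableRel G.Adj] : Set ℝ :=
  {μ : ℝ | Module.End.HasEigenvalue (Matrix.toLin' (G.adjMatrix ℝ)) μ}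

end SimpleGraph

/-! Let A be the adjacency matrix and m its minimal polynomial, of degree d+1 since A is
diagonalizable. Short walks cannot have the wrong parity relative to the distance of their ends, so
splitting m(A) = 0 by parity of exponents leaves a nonzero p(A) supported on pairs at distance d
(`exists_aeval_adjMatrix_supported_at_dist`). This p is a unit modulo m. Linear algebra then gives,
for each i ≤ d, a nonzero multiple of p modulo m of degree at most i. Its matrix is supported
exactly at distance i: the degree kills larger distances, the factor p(A) smaller ones
(`exists_degree_le_aeval_adjMatrix_supported_at_dist`). These polynomials span everything modulo m.
Constant diagonals make the graph regular, so by Hoffman the all-ones matrix is a polynomial in A;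
expanding it in this basis exhibits the distance matrices as polynomials in A, and
distance-regularity follows. -/

namespace SimpleGraph

open Polynomial

/-! ### Parity of walks and odd cycles. -/

section Walks

variable {V : Type*} {G : SimpleGraph V}

/-- Bypassing cuts out closed detours: even ones preserve parity, and an odd one is an edge plus a
path, hence a cycle. -/
theorem Walk.bypass_length_mod_two_or_exists_odd_isCycle [DecidableEq V] {u v : V}
    (p : G.Walk u v) :
    p.bypass.length % 2 = p.length % 2 ∨
      ∃ (a : V) (w : G.Walk a a), w.IsCycle ∧ Odd w.length ∧ w.length ≤ p.length := by
  induction p with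
  | nil => left; simp [Walk.bypass]
  | @cons u x v h q ih =>
    rcases ih with ih | ⟨a, w, hw, hw', hle⟩
    · by_cases hu : u ∈ q.bypass.support
      · have hlen : (q.bypass.takeUntil u hu).length + (q.bypass.dropUntil u hu).length
            = q.bypass.length := by
          rw [← Walk.length_append, Walk.take_spec]
        have hle := q.length_bypass_le_length
        by_cases hpar : Odd (q.bypass.takeUntil u hu).length
        · left
          rw [Nat.odd_iff] at hpar
          simp only [Walk.bypass, hu, dif_pos, Walk.length_cons]
          omega
        · right
          have hpath : (q.bypass.takeUntil u hu).IsPath := q.bypass_isPath.takeUntil hu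
          rw [Nat.not_odd_iff] at hpar
          refine ⟨u, Walk.cons h (q.bypass.takeUntil u hu), ?_, ?_, ?_⟩
          · rw [Walk.cons_isCycle_iff]
            -- A path containing the edge joining its ends is that edge alone, of odd length 1.
            refine ⟨hpath, fun hmem => ?_⟩
            rw [Sym2.eq_swap] at hmem
            have := hpath.length_eq_one_of_mem_edges hmem
            omega
          · rw [Nat.odd_iff, Walk.length_cons]; omega
          · simp only [Walk.length_cons]; omega
      · left
        simp only [Walk.bypass, hu, dif_neg, Walk.length_cons, not_false_eq_true]
        omega
    · exact .inr ⟨a, w, hw, hw', hle.trans (by simp)⟩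

theorem le_oddGirth {n : ℕ∞} :
    n ≤ G.oddGirth ↔ ∀ (a : V) (w : G.Walk a a), w.IsCycle → Odd w.length → n ≤ w.length := by
  simp [oddGirth]

theorem oddGirth_le_length_of_odd {a : V} (w : G.Walk a a) (hw : Odd w.length) :
    G.oddGirth ≤ w.length := by
  classical
  rcases w.bypass_length_mod_two_or_exists_odd_isCycle with h | ⟨b, c, hc, hodd, hle⟩
  · have : w.bypass = Walk.nil := by
      simpa using w.bypass_isPath
    rw [this] at h
    rw [Nat.odd_iff] at hw
    simp [hw] at h
  · exact (le_oddGirth.mp le_rfl b c hc hodd).trans (Nat.cast_le.mpr hle)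

theorem exists_odd_isCycle_length_eq_oddGirth (h : G.oddGirth ≠ ⊤) :
    ∃ (a : V) (w : G.Walk a a), w.IsCycle ∧ Odd w.length ∧ (w.length : ℕ∞) = G.oddGirth := by
  by_contra! hne
  have : G.oddGirth + 1 ≤ G.oddGirth := le_oddGirth.mpr fun a w hw hodd =>
    Order.add_one_le_of_lt ((oddGirth_le_length_of_odd w hodd).lt_of_ne (hne a w hw hodd).symm)
  exact absurd this (not_le_of_gt (ENat.lt_add_one_iff h |>.mpr le_rfl))

/-- A walk whose length has not the parity of a geodesic closes up with a geodesic to an odd closed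
walk, so that it cannot be short. -/
theorem Walk.oddGirth_le_length_add_dist {u v : V} (p : G.Walk u v)
    (h : Odd (p.length + G.dist u v)) : G.oddGirth ≤ (p.length + G.dist u v : ℕ) := by
  obtain ⟨q, hq⟩ := p.reachable.exists_walk_length_eq_dist
  have := oddGirth_le_length_of_odd (p.append q.reverse) (by simpa [hq] using h)
  simpa [hq] using this

theorem exists_dist_eq_and_walk_length_eq_of_oddGirth {d : ℕ}
    (h : G.oddGirth = ((2 * d + 1 : ℕ) : ℕ∞)) :
    ∃ (u v : V) (p : G.Walk u v), G.dist u v = d ∧ p.length = d + 1 := by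
  obtain ⟨a, w, -, -, hw⟩ := exists_odd_isCycle_length_eq_oddGirth (G := G) (h ▸ ENat.natCast_ne_top _)
  rw [h, Nat.cast_inj] at hw
  have h₁ : (w.take d).length = d := by simp [Walk.take_length, hw]; omega
  have h₂ : (w.drop d).length = d + 1 := by simp [Walk.drop_length, hw]; omega
  refine ⟨_, _, (w.drop d).reverse, ?_, by simpa using h₂⟩
  -- The two arcs have lengths d and d+1. If the distance were below d, the arc of parity opposite
  -- to it would close up to an odd walk of length at most 2d.
  have hle := h₁ ▸ dist_le (w.take d)
  by_contra hne
  rcases Nat.even_or_odd (d + G.dist a (w.getVert d)) with hp | hp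
  · have := (w.drop d).reverse.oddGirth_le_length_add_dist (by
      rw [Walk.length_reverse, h₂]
      grind)
    rw [h, Walk.length_reverse, h₂, Nat.cast_le] at this
    omega
  · have := (w.take d).oddGirth_le_length_add_dist (by rwa [h₁])
    rw [h, h₁, Nat.cast_le] at this
    omega

end Walks

/-! ### Entries of polynomials in the adjacency matrix. -/

section Matrices

variable {V : Type*} [Fintype V] [DecidableEq V] {G : SimpleGraph V} [DecidableRel G.Adj]

theorem adjMatrix_pow_apply_pos {u v : V} (p : G.Walk u v) :
    0 < (G.adjMatrix ℝ ^ p.length) u v := by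
  rw [adjMatrix_pow_apply_eq_card_walk, Nat.cast_pos, Fintype.card_pos_iff]
  exact ⟨⟨p, rfl⟩⟩

theorem exists_walk_of_adjMatrix_pow_apply_ne_zero {n : ℕ} {u v : V}
    (h : (G.adjMatrix ℝ ^ n) u v ≠ 0) : ∃ p : G.Walk u v, p.length = n := by
  rw [adjMatrix_pow_apply_eq_card_walk, Nat.cast_ne_zero] at h
  obtain ⟨p, hp⟩ := Fintype.card_pos_iff.mp (Nat.pos_of_ne_zero h)
  exact ⟨p, hp⟩

theorem adjMatrix_pow_apply_eq_zero_of_lt_dist {n : ℕ} {u v : V} (h : n < G.dist u v) :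
    (G.adjMatrix ℝ ^ n) u v = 0 := by
  by_contra h0
  obtain ⟨p, rfl⟩ := exists_walk_of_adjMatrix_pow_apply_ne_zero h0
  exact absurd (dist_le p) (by omega)

theorem aeval_adjMatrix_apply_eq_zero_of_degree_lt_dist {f : ℝ[X]} {u v : V}
    (h : f.degree < G.dist u v) : aeval (G.adjMatrix ℝ) f u v = 0 := by
  rw [aeval_eq_sum_range, Matrix.sum_apply]
  refine Finset.sum_eq_zero fun j _ => ?_
  rw [Matrix.smul_apply]
  rcases lt_or_ge j (G.dist u v) with hj | hj
  · rw [adjMatrix_pow_apply_eq_zero_of_lt_dist hj, smul_zero]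
  · rw [coeff_eq_zero_of_degree_lt (h.trans_le (by exact_mod_cast hj)), zero_smul]

theorem aeval_adjMatrix_apply_comm (f : ℝ[X]) (u v : V) :
    aeval (G.adjMatrix ℝ) f u v = aeval (G.adjMatrix ℝ) f v u := by
  have : (aeval (G.adjMatrix ℝ) f).transpose = aeval (G.adjMatrix ℝ) f := by
    simp [aeval_eq_sum_range, Matrix.transpose_sum, Matrix.transpose_pow]
  exact congrFun (congrFun this v) u

end Matrices

end SimpleGraph

/-- Diagonalizability makes the minimal polynomial split with simple roots, which are the
eigenvalues. -/
theorem Matrix.IsHermitian.natDegree_minpoly_eq_ncard {n : Type*} [Fintype n] [DecidableEq n]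
    {A : Matrix n n ℝ} (hA : A.IsHermitian) :
    (minpoly ℝ A).natDegree = {μ : ℝ | Module.End.HasEigenvalue (Matrix.toLin' A) μ}.ncard := by
  have hne : minpoly ℝ A ≠ 0 := minpoly.ne_zero (Matrix.isIntegral A)
  have hsq : Squarefree (minpoly ℝ A) := by
    have h := (Module.End.isFinitelySemisimple_iff_isSemisimple.mp
      (Matrix.isSymmetric_toEuclideanLin_iff.mpr hA).isFinitelySemisimple).minpoly_squarefree
    exact minpoly.algEquiv_eq (Matrix.toLpLinAlgEquiv (R := ℝ) 2) A ▸ h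
  have hsplit : (minpoly ℝ A).Splits :=
    hA.splits_charpoly.of_dvd A.charpoly_monic.ne_zero A.minpoly_dvd_charpoly
  have hset : {μ : ℝ | Module.End.HasEigenvalue (Matrix.toLin' A) μ} =
      (minpoly ℝ A).roots.toFinset := by
    ext μ
    simp [Module.End.hasEigenvalue_iff_isRoot, hne]
  rw [hset, Set.ncard_coe_finset, Multiset.toFinset_card_of_nodup
    (Polynomial.nodup_roots (PerfectField.separable_iff_squarefree.mpr hsq)),
    hsplit.natDegree_eq_card_roots]

/-! ### Polynomials in A supported at a single distance. -/

namespace SimpleGraph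

open Polynomial

variable {V : Type*} [Fintype V] [DecidableEq V] {G : SimpleGraph V} [DecidableRel G.Adj]

/-- The terms of exponent congruent to `d` modulo `2` of the minimal polynomial of the adjacency
matrix give a matrix supported on the pairs of vertices at distance `d`. -/
theorem exists_aeval_adjMatrix_supported_at_dist {d : ℕ}
    (hmin : (minpoly ℝ (G.adjMatrix ℝ)).natDegree = d + 1)
    (hodd : G.oddGirth = ((2 * d + 1 : ℕ) : ℕ∞)) :
    ∃ p : ℝ[X], aeval (G.adjMatrix ℝ) p ≠ 0 ∧
      ∀ u v, G.dist u v ≠ d → aeval (G.adjMatrix ℝ) p u v = 0 := by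
  set A := G.adjMatrix ℝ with hA
  set m := minpoly ℝ A with hm
  have hpow : ∀ {j : ℕ} {u v : V}, Odd (j + G.dist u v) → j + G.dist u v < 2 * d + 1 →
      (A ^ j) u v = 0 := by
    intro j u v h₁ h₂
    by_contra h0
    obtain ⟨w, rfl⟩ := exists_walk_of_adjMatrix_pow_apply_ne_zero h0
    have := w.oddGirth_le_length_add_dist h₁
    rw [hodd, Nat.cast_le] at this
    omega
  set S := fun r : ℕ => ∑ j ∈ (Finset.range (d + 2)).filter (fun j => j % 2 = r % 2),
    m.coeff j • A ^ j with hS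
  have hsum : S d + S (d + 1) = 0 := by
    rw [← minpoly.aeval ℝ A, aeval_eq_sum_range' (n := d + 2) (by rw [← hm, hmin]; omega) A,
      ← Finset.sum_filter_add_sum_filter_not _ (fun j => j % 2 = d % 2)]
    refine congrArg _ (Finset.sum_congr (Finset.filter_congr fun j _ => ?_) fun _ _ => rfl)
    omega
  have hsum' : ∀ u v, S d u v = - S (d + 1) u v := fun u v => by
    rw [eq_neg_iff_add_eq_zero, ← Matrix.add_apply, hsum, Matrix.zero_apply]
  have hzero : ∀ r u v, (∀ j < d + 2, j % 2 = r % 2 → (A ^ j) u v = 0) → S r u v = 0 := by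
    intro r u v h
    simp only [hS, Matrix.sum_apply]
    refine Finset.sum_eq_zero fun j hj => ?_
    rw [Finset.mem_filter, Finset.mem_range] at hj
    rw [Matrix.smul_apply, h j hj.1 hj.2, smul_zero]
  refine ⟨∑ j ∈ (Finset.range (d + 2)).filter (fun j => j % 2 = d % 2), C (m.coeff j) * X ^ j, ?_⟩
  have haeval : aeval A (∑ j ∈ (Finset.range (d + 2)).filter (fun j => j % 2 = d % 2),
      C (m.coeff j) * X ^ j) = S d := by
    simp [hS, Algebra.smul_def]
  rw [haeval]
  constructor
  · obtain ⟨u, v, w, hdist, hlen⟩ := exists_dist_eq_and_walk_length_eq_of_oddGirth hodd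
    intro h0
    have h1 := hsum' u v
    rw [h0, Matrix.zero_apply, zero_eq_neg] at h1
    simp only [hS, Matrix.sum_apply] at h1
    -- The other exponents of this parity are below d, the distance of u and v.
    rw [Finset.sum_eq_single_of_mem (d + 1) (by simp)] at h1
    · have h2 : m.coeff (d + 1) = 1 := by
        rw [← hmin]
        exact minpoly.monic (Matrix.isIntegral A)
      rw [h2, one_smul, ← hlen] at h1
      exact (adjMatrix_pow_apply_pos w).ne' h1
    · intro j hj hne
      rw [Finset.mem_filter, Finset.mem_range] at hj
      rw [Matrix.smul_apply, adjMatrix_pow_apply_eq_zero_of_lt_dist (by omega), smul_zero]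
  · intro u v hne
    -- Below distance d, the half of parity opposite to the distance vanishes, as exponent plus
    -- distance is at most 2d; the other half is its negative. Beyond d, parity excludes the
    -- exponent d+1, so every exponent in `S d` is too small.
    rcases lt_or_gt_of_ne hne with hlt | hgt
    · by_cases hpar : G.dist u v % 2 = d % 2
      · rw [hsum', hzero, neg_zero]
        exact fun j hj hjr => hpow (by rw [Nat.odd_iff]; omega) (by omega)
      · exact hzero d u v fun j hj hjr => hpow (by rw [Nat.odd_iff]; omega) (by omega)
    · exact hzero d u v fun j hj hjr => adjMatrix_pow_apply_eq_zero_of_lt_dist (by omega)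

theorem aeval_adjMatrix_eq_zero_of_degree_lt {f : ℝ[X]}
    (hf : f.degree < (minpoly ℝ (G.adjMatrix ℝ)).degree) (h : aeval (G.adjMatrix ℝ) f = 0) :
    f = 0 := by
  by_contra h0
  exact absurd (minpoly.degree_le_of_ne_zero ℝ _ h0 h) (not_le_of_gt hf)

/-- A common factor yields f of degree at most d with f(A)p(A) = 0, so p(A)² = r(A)p(A) with r = p
mod f of degree below d. The supports of r(A) and p(A) are disjoint, so the symmetric matrix p(A)
has a square with zero diagonal and must vanish. -/
theorem isCoprime_minpoly_adjMatrix_of_supported_at_dist {d : ℕ}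
    (hmin : (minpoly ℝ (G.adjMatrix ℝ)).natDegree = d + 1) {p : ℝ[X]}
    (hp : aeval (G.adjMatrix ℝ) p ≠ 0)
    (hsupp : ∀ u v, G.dist u v ≠ d → aeval (G.adjMatrix ℝ) p u v = 0) :
    IsCoprime p (minpoly ℝ (G.adjMatrix ℝ)) := by
  set A := G.adjMatrix ℝ with hA
  have hm0 : minpoly ℝ A ≠ 0 := minpoly.ne_zero (Matrix.isIntegral A)
  refine isCoprime_of_irreducible_dvd (fun h => hm0 h.2) ?_
  rintro q hq ⟨p', hp'⟩ ⟨f, hf⟩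
  have hf0 : f ≠ 0 := by rintro rfl; simp [hf] at hm0
  have hfd : f.natDegree ≤ d := by
    have h1 := natDegree_mul hq.ne_zero hf0
    have h2 := hq.natDegree_pos
    rw [← hf, hmin] at h1
    omega
  have hfp : aeval A f * aeval A p = 0 := by
    rw [← map_mul, show f * p = minpoly ℝ A * p' by rw [hp', hf]; ring, map_mul, minpoly.aeval,
      zero_mul]
  have hr : (p % f).degree < d := (EuclideanDomain.mod_lt p hf0).trans_le
    (degree_le_natDegree.trans (by exact_mod_cast hfd))
  have hsq : aeval A p * aeval A p = aeval A (p % f) * aeval A p := by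
    rw [← map_mul, ← map_mul, ← sub_eq_zero, ← map_sub,
      show p * p - p % f * p = p / f * (f * p) by
        linear_combination -p * EuclideanDomain.div_add_mod p f,
      map_mul, map_mul, hfp, mul_zero]
  refine hp (Matrix.ext fun u v => ?_)
  have hdiag : (aeval A p * aeval A p) u u = 0 := by
    rw [hsq, Matrix.mul_apply]
    refine Finset.sum_eq_zero fun w _ => ?_
    by_cases hw : G.dist w u = d
    · rw [aeval_adjMatrix_apply_eq_zero_of_degree_lt_dist (by rwa [dist_comm, hw]), zero_mul]
    · rw [hsupp w u hw, mul_zero]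
  rw [Matrix.mul_apply, Finset.sum_eq_zero_iff_of_nonneg] at hdiag
  · have := hdiag v (Finset.mem_univ v)
    rwa [aeval_adjMatrix_apply_comm p v u, mul_self_eq_zero] at this
  · intro w _
    rw [aeval_adjMatrix_apply_comm p w u]
    exact mul_self_nonneg _

theorem exists_degree_le_aeval_adjMatrix_supported_at_dist (hconn : G.Connected) {d : ℕ}
    (hmin : (minpoly ℝ (G.adjMatrix ℝ)).natDegree = d + 1) {p : ℝ[X]}
    (hp : aeval (G.adjMatrix ℝ) p ≠ 0)
    (hsupp : ∀ u v, G.dist u v ≠ d → aeval (G.adjMatrix ℝ) p u v = 0) {i : ℕ} (hi : i ≤ d) :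
    ∃ f : ℝ[X], f.degree = i ∧ ∀ u v, G.dist u v ≠ i → aeval (G.adjMatrix ℝ) f u v = 0 := by
  have hcop := isCoprime_minpoly_adjMatrix_of_supported_at_dist hmin hp hsupp
  set A := G.adjMatrix ℝ with hA
  set m := minpoly ℝ A with hm
  have hmonic : m.Monic := minpoly.monic (Matrix.isIntegral A)
  have hmdeg : m.degree = (d + 1 : ℕ) := by rw [degree_eq_natDegree hmonic.ne_zero, hmin]
  -- Reads off the coefficients i+1, ..., d of gp mod m: d-i equations in the d-i+1 coefficients of
  -- g.
  let L : degreeLT ℝ (d - i + 1) →ₗ[ℝ] (Fin (d - i) → ℝ) :=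
    LinearMap.pi (fun j => lcoeff ℝ (i + 1 + j)) ∘ₗ modByMonicHom m ∘ₗ
      LinearMap.mulRight ℝ p ∘ₗ (degreeLT ℝ (d - i + 1)).subtype
  have : FiniteDimensional ℝ (degreeLT ℝ (d - i + 1)) :=
    (degreeLTEquiv ℝ (d - i + 1)).symm.finiteDimensional
  have hker : L.ker ≠ ⊥ := L.ker_ne_bot_of_finrank_lt (by
    rw [(degreeLTEquiv ℝ (d - i + 1)).finrank_eq]; simp)
  obtain ⟨⟨g, hgdeg⟩, hgker, hg0⟩ := Submodule.exists_mem_ne_zero_of_ne_bot hker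
  replace hg0 : g ≠ 0 := fun h => hg0 (Subtype.ext h)
  rw [mem_degreeLT] at hgdeg
  set f := (g * p) %ₘ m with hf
  have hcoeff : ∀ j : Fin (d - i), f.coeff (i + 1 + j) = 0 := fun j =>
    congrFun (LinearMap.mem_ker.mp hgker) j
  have hfdeg : f.degree < m.degree := degree_modByMonic_lt _ hmonic
  have hfi : f.degree ≤ i := by
    rw [degree_le_iff_coeff_zero]
    intro j hj
    rw [Nat.cast_lt] at hj
    rcases le_or_gt j d with hjd | hjd
    · have := hcoeff ⟨j - (i + 1), by omega⟩
      rwa [show i + 1 + (j - (i + 1)) = j by omega] at this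
    · exact coeff_eq_zero_of_degree_lt (hfdeg.trans_le (by rw [hmdeg]; exact_mod_cast hjd))
  have hfA : aeval A f = aeval A g * aeval A p := by
    rw [hf, ← map_mul]
    conv_rhs => rw [← modByMonic_add_div (g * p) m]
    rw [map_add, map_mul, minpoly.aeval, zero_mul, add_zero]
  have hf0 : f ≠ 0 := by
    intro h
    have hdvd : m ∣ g := hcop.symm.dvd_of_dvd_mul_right ((modByMonic_eq_zero_iff_dvd hmonic).mp h)
    have h1 := (degree_le_of_dvd hdvd hg0).trans_lt hgdeg
    rw [hmdeg, Nat.cast_lt] at h1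
    omega
  have hfsupp : ∀ u v, G.dist u v ≠ i → aeval A f u v = 0 := by
    intro u v huv
    rcases lt_or_gt_of_ne huv with hlt | hgt
    · rw [hfA, Matrix.mul_apply]
      refine Finset.sum_eq_zero fun w _ => ?_
      by_cases hw : G.dist w v = d
      · have := hconn.dist_triangle (u := w) (v := u) (w := v)
        rw [aeval_adjMatrix_apply_eq_zero_of_degree_lt_dist (hgdeg.trans_le _), zero_mul]
        rw [Nat.cast_le, dist_comm]
        omega
      · rw [hsupp w v hw, mul_zero]
    · exact aeval_adjMatrix_apply_eq_zero_of_degree_lt_dist (hfi.trans_lt (by exact_mod_cast hgt))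
  refine ⟨f, hfi.eq_of_not_lt fun hlt => hf0 ?_, hfsupp⟩
  refine aeval_adjMatrix_eq_zero_of_degree_lt hfdeg (Matrix.ext fun u v => ?_)
  by_cases huv : G.dist u v = i
  · exact aeval_adjMatrix_apply_eq_zero_of_degree_lt_dist (by rwa [huv])
  · exact hfsupp u v huv

end SimpleGraph

theorem Polynomial.exists_eq_sum_smul_of_degree_eq {K : Type*} [Field K] {b : ℕ → Polynomial K}
    {n : ℕ} (hb : ∀ i < n, (b i).degree = i) {f : Polynomial K} (hf : f.degree < n) :
    ∃ x : ℕ → K, f = ∑ i ∈ Finset.range n, x i • b i := by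
  induction n generalizing f with
  | zero =>
    refine ⟨0, ?_⟩
    rw [Finset.sum_range_zero, ← degree_eq_bot]
    simpa [Nat.WithBot.lt_zero_iff] using hf
  | succ n ih =>
    have hn := hb n n.lt_succ_self
    have hlead : (b n).coeff n ≠ 0 := coeff_ne_zero_of_eq_degree hn
    have hlt : (f - (f.coeff n / (b n).coeff n) • b n).degree < n := by
      rw [degree_lt_iff_coeff_zero]
      intro j hj
      rcases eq_or_ne j n with rfl | hne
      · simp [hlead]
      · have hj' : n < j := hj.lt_of_ne' hne
        rw [coeff_sub, coeff_smul,
          coeff_eq_zero_of_degree_lt (n := j) (p := f) (hf.trans_le (by exact_mod_cast hj')),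
          coeff_eq_zero_of_degree_lt (n := j) (hn.trans_lt (by exact_mod_cast hj')), smul_zero, sub_zero]
    obtain ⟨x, hx⟩ := ih (fun i hi => hb i (by omega)) hlt
    refine ⟨Function.update x n (f.coeff n / (b n).coeff n), ?_⟩
    rw [Finset.sum_range_succ, Function.update_self, ← sub_eq_iff_eq_add, hx]
    refine Finset.sum_congr rfl fun i hi => ?_
    rw [Function.update_of_ne (Finset.mem_range.mp hi).ne]

/-! ### Hoffman's polynomial and distance-regularity. -/

namespace SimpleGraph

open Polynomial

variable {V : Type*} [Fintype V] [DecidableEq V] {G : SimpleGraph V} [DecidableRel G.Adj]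

/-- Hoffman: the all-ones matrix of a connected regular graph is a polynomial in the adjacency
matrix. -/
theorem Connected.exists_aeval_adjMatrix_eq_one (hconn : G.Connected) {k : ℕ}
    (hreg : G.IsRegularOfDegree k) : ∃ f : ℝ[X], ∀ u v, aeval (G.adjMatrix ℝ) f u v = 1 := by
  set A := G.adjMatrix ℝ with hA
  have hint : IsIntegral ℝ A := Matrix.isIntegral A
  obtain ⟨u₀⟩ := hconn.nonempty
  have hroot : (minpoly ℝ A).IsRoot k := by
    rw [← Matrix.minpoly_toLin', ← Module.End.hasEigenvalue_iff_isRoot]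
    refine Module.End.hasEigenvalue_of_hasEigenvector (x := fun _ => 1) ⟨?_, fun h => ?_⟩
    · rw [Module.End.mem_eigenspace_iff]
      ext v
      simp [hA, adjMatrix_mulVec_apply, hreg.degree_eq v]
    · exact one_ne_zero (congrFun h u₀)
  obtain ⟨h, hh⟩ := dvd_iff_isRoot.mpr hroot
  have hm0 : minpoly ℝ A ≠ 0 := minpoly.ne_zero hint
  have hh0 : h ≠ 0 := by rintro rfl; simp [hh] at hm0
  have hhA : aeval A h ≠ 0 := by
    intro h0
    refine hh0 (aeval_adjMatrix_eq_zero_of_degree_lt ?_ h0)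
    rw [← hA, hh, degree_mul, degree_X_sub_C, degree_eq_natDegree hh0]
    exact_mod_cast Nat.lt_one_add_iff.mpr le_rfl
  have hmul : A * aeval A h = (k : ℝ) • aeval A h := by
    have := minpoly.aeval ℝ A
    rw [hh, map_mul, map_sub, aeval_X, aeval_C, sub_mul, sub_eq_zero] at this
    rw [this, Algebra.smul_def]
  -- Columns of h(A) are killed by A - k, minus the Laplacian by regularity, so connectedness makes
  -- them constant.
  have hcol : ∀ u u' v, aeval A h u v = aeval A h u' v := by
    intro u u' v
    refine (G.lapMatrix_mulVec_eq_zero_iff_forall_reachable (x := fun w => aeval A h w v)).mp ?_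
      u u' (hconn u u')
    ext w
    have hw := congrFun (congrFun hmul w) v
    rw [hA, adjMatrix_mul_apply, ← hA, Matrix.smul_apply, smul_eq_mul] at hw
    rw [lapMatrix_mulVec_apply, hreg.degree_eq, hw, sub_self, Pi.zero_apply]
  have hconst : ∀ u v, aeval A h u v = aeval A h u₀ u₀ := by
    intro u v
    rw [hcol u u₀ v, aeval_adjMatrix_apply_comm, hcol v u₀ u₀]
  have hne : aeval A h u₀ u₀ ≠ 0 := fun h0 =>
    hhA (Matrix.ext fun u v => by rw [hconst, h0, Matrix.zero_apply])
  refine ⟨C (aeval A h u₀ u₀)⁻¹ * h, fun u v => ?_⟩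
  rw [map_mul, aeval_C, ← Algebra.smul_def, Matrix.smul_apply, hconst u v, smul_eq_mul]
  exact inv_mul_cancel₀ hne

/-- If, for every `i`, some polynomial in the adjacency matrix is the distance-`i` matrix, and
polynomials in the adjacency matrix are constant on pairs at a given distance, then the graph is
distance-regular. -/
theorem isDistanceRegular_of_aeval_adjMatrix (hconn : G.Connected)
    (hdist : ∀ i, ∃ f : ℝ[X], ∀ u v,
      aeval (G.adjMatrix ℝ) f u v = if G.dist u v = i then 1 else 0)
    (hconst : ∀ f : ℝ[X], ∃ φ : ℕ → ℝ, ∀ u v, aeval (G.adjMatrix ℝ) f u v = φ (G.dist u v)) :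
    G.IsDistanceRegular := by
  have key : ∀ j i : ℕ, ∃ n : ℕ, ∀ u v, G.dist u v = i →
      {w : V | G.Adj v w ∧ G.dist u w = j}.ncard = n := by
    intro j i
    obtain ⟨f, hf⟩ := hdist j
    obtain ⟨φ, hφ⟩ := hconst (f * X)
    -- The count is an entry of the distance-j matrix times A, again a polynomial in A.
    have hcard : ∀ u v, ({w : V | G.Adj v w ∧ G.dist u w = j}.ncard : ℝ) = φ (G.dist u v) := by
      intro u v
      rw [← hφ, map_mul, aeval_X, mul_adjMatrix_apply, Set.ncard_eq_toFinset_card']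
      simp_rw [hf]
      rw [Finset.sum_boole]
      congr 2
      ext w
      simp
    by_cases hex : ∃ u v, G.dist u v = i
    · obtain ⟨u₀, v₀, h₀⟩ := hex
      refine ⟨{w : V | G.Adj v₀ w ∧ G.dist u₀ w = j}.ncard, fun u v h => ?_⟩
      rw [← Nat.cast_inj (R := ℝ), hcard, hcard, h, h₀]
    · exact ⟨0, fun u v h => absurd ⟨u, v, h⟩ hex⟩
  choose N hN using key
  refine ⟨hconn, fun i => N (i + 1) i, fun i => if i = 0 then 0 else N (i - 1) i,
    fun i u v h => ⟨?_, hN _ _ u v h⟩⟩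
  rcases i with _ | i
  · simp
  · simpa using hN i (i + 1) u v h

theorem isDistanceRegular_of_supported_at_dist (hconn : G.Connected) {d : ℕ}
    (hmin : (minpoly ℝ (G.adjMatrix ℝ)).natDegree = d + 1) {p : ℝ[X]}
    (hp : aeval (G.adjMatrix ℝ) p ≠ 0)
    (hsupp : ∀ u v, G.dist u v ≠ d → aeval (G.adjMatrix ℝ) p u v = 0) :
    G.IsDistanceRegular := by
  have hex : ∀ i, ∃ f : ℝ[X], i ≤ d → f.degree = i ∧
      ∀ u v, G.dist u v ≠ i → aeval (G.adjMatrix ℝ) f u v = 0 := by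
    intro i
    by_cases hi : i ≤ d
    · obtain ⟨f, hf⟩ := exists_degree_le_aeval_adjMatrix_supported_at_dist hconn hmin hp hsupp hi
      exact ⟨f, fun _ => hf⟩
    · exact ⟨0, fun h => absurd h hi⟩
  choose b hb using hex
  set A := G.adjMatrix ℝ with hA
  have hmonic : (minpoly ℝ A).Monic := minpoly.monic (Matrix.isIntegral A)
  have hspan : ∀ f : ℝ[X], ∃ x : ℕ → ℝ, ∀ u v, aeval A f u v =
      if G.dist u v ≤ d then x (G.dist u v) * aeval A (b (G.dist u v)) u v else 0 := by
    intro f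
    have hdeg : (f %ₘ minpoly ℝ A).degree < (d + 1 : ℕ) := by
      rw [← hmin, ← degree_eq_natDegree hmonic.ne_zero]
      exact degree_modByMonic_lt _ hmonic
    obtain ⟨x, hx⟩ := exists_eq_sum_smul_of_degree_eq (fun i hi => (hb i (by omega)).1) hdeg
    refine ⟨x, fun u v => ?_⟩
    have hfA : aeval A f = ∑ i ∈ Finset.range (d + 1), x i • aeval A (b i) := by
      conv_lhs => rw [← modByMonic_add_div f (minpoly ℝ A), hx]
      simp
    rw [hfA, Matrix.sum_apply]
    have hz : ∀ i ∈ Finset.range (d + 1), i ≠ G.dist u v → (x i • aeval A (b i)) u v = 0 := by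
      intro i hi hne
      rw [Finset.mem_range] at hi
      rw [Matrix.smul_apply, (hb i (by omega)).2 u v hne.symm, smul_zero]
    split_ifs with hle
    · rw [Finset.sum_eq_single_of_mem _ (Finset.mem_range.mpr (by omega)) hz, Matrix.smul_apply,
        smul_eq_mul]
    · refine Finset.sum_eq_zero fun i hi => hz i hi ?_
      rw [Finset.mem_range] at hi
      omega
  -- Only the constant `b 0` contributes to diagonals; that of A² lists the degrees.
  have hdiag : ∀ u v, aeval A (X ^ 2 : ℝ[X]) u u = aeval A (X ^ 2 : ℝ[X]) v v := by
    intro u v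
    obtain ⟨x, hx⟩ := hspan (X ^ 2)
    rw [hx, hx, dist_self, dist_self, eq_C_of_degree_eq_zero (hb 0 d.zero_le).1]
    simp [Matrix.algebraMap_matrix_apply]
  obtain ⟨u₀⟩ := hconn.nonempty
  have hreg : G.IsRegularOfDegree (G.degree u₀) := by
    intro v
    have := hdiag v u₀
    rwa [map_pow, aeval_X, pow_two, hA, adjMatrix_mul_self_apply_self,
      adjMatrix_mul_self_apply_self, Nat.cast_inj] at this
  obtain ⟨J, hJ⟩ := hconn.exists_aeval_adjMatrix_eq_one hreg
  obtain ⟨x, hx⟩ := hspan J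
  have hdle : ∀ u v, G.dist u v ≤ d := by
    intro u v
    by_contra h
    have := hx u v
    rw [hJ, if_neg h] at this
    exact one_ne_zero this
  have hxb : ∀ u v, x (G.dist u v) * aeval A (b (G.dist u v)) u v = 1 := by
    intro u v
    rw [← hJ u v, hx, if_pos (hdle u v)]
  refine isDistanceRegular_of_aeval_adjMatrix hconn (fun i => ?_) fun f => ?_
  · by_cases hi : i ≤ d
    · refine ⟨C (x i) * b i, fun u v => ?_⟩
      rw [← hA, map_mul, aeval_C, ← Algebra.smul_def, Matrix.smul_apply, smul_eq_mul]
      split_ifs with h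
      · rw [← h, hxb]
      · rw [(hb i hi).2 u v h, mul_zero]
    · refine ⟨0, fun u v => ?_⟩
      rw [if_neg (fun h : G.dist u v = i => hi (h ▸ hdle u v)), map_zero, Matrix.zero_apply]
  · obtain ⟨y, hy⟩ := hspan f
    -- By `hxb`, `x i` is nonzero at every distance i that occurs.
    refine ⟨fun i => y i / x i, fun u v => ?_⟩
    rw [hy, if_pos (hdle u v), eq_inv_of_mul_eq_one_right (hxb u v)]
    exact (div_eq_mul_inv _ _).symm

end SimpleGraph

theorem theorem1 {V : Type*} [Fintype V] [DecidableEq V] (G : SimpleGraph V) [DecidableRel G.Adj]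
    (d : ℕ) (hconn : G.Connected) (heig : G.adjEigenvalues.ncard = d + 1)
    (hodd : G.oddGirth = ((2 * d + 1 : ℕ) : ℕ∞)) :
    G.IsDistanceRegular := by
  have hmin : (minpoly ℝ (G.adjMatrix ℝ)).natDegree = d + 1 :=
    (G.isHermitian_adjMatrix (R := ℝ)).natDegree_minpoly_eq_ncard.trans heig
  obtain ⟨p, hp, hsupp⟩ := SimpleGraph.exists_aeval_adjMatrix_supported_at_dist hmin hodd
  exact SimpleGraph.isDistanceRegular_of_supported_at_dist hconn hmin hp hsupp
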